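/- **Proposition 4.4.** *Setting.* Let $\eta\in\mathbb C$ with $\sinh\eta\neq0$, and put $b(u)=\frac{\sinh u}{\sinh(u+\eta)}$, $c(u)=\frac{\sinh\eta}{\sinh(u+\eta)}$. Let $R(u)$ be the matrix on $\mathbb C^2\otimes\mathbb C^2$ with rows $(1,0,0,0)$, $(0,b(u),c(u),0)$, $(0,c(u),b(u),0)$, $(0,0,0,1)$ in the basis $|00\rangle,|01\rangle,|10\rangle,|11\rangle$. For inhomogeneities $w=(w_1,\dots,w_L)$ let $$T(\lambda;w)=R_{0L}(\lambda-w_L)\cdots R_{01}(\lambda-w_1)$$ act on $\mathbb C^2_0\otimes(\mathbb C^2)^{\otimes L}$, let $T_{\alpha,\beta}$ ($\alpha,\beta\in\{0,1\}$) be its operator-valued entries with respect to the auxiliary space $0$, and put $B=T_{0,1}$, $C=T_{1,0}$. Let $|0\rangle$ be the basis vector with all spins $0$ (up), and let $e_j^{\alpha,\beta}$ be the matrix unit with entry $1$ in row $\alpha$, column $\beta$, acting at site $j$. Let $N_s\ge1$, $\ell\ge0$, $L=\ell N_s$, $\xi_1,\dots,\xi_{N_s}\in\mathbb C$, and let $r_k^{(\beta)}\in\mathbb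 C$ ($1\le k\le N_s$, $1\le\beta\le\ell$) be pairwise distinct. For $\epsilon\in\mathbb C$ put $$w^{(\ell;\epsilon)}_{\ell(k-1)+\beta}=\xi_k-(\beta-1)\eta+\epsilon\, r_k^{(\beta)},\qquad w^{(\ell)}_j=w^{(\ell;0)}_j .$$ Write $T^{(\epsilon)},B^{(\epsilon)},C^{(\epsilon)}$ for $T,B,C$ with inhomogeneities $w^{(\ell;\epsilon)}$. *Bethe roots.* For a function $\delta$, the Bethe-ansatz equations for $\lambda_1,\dots,\lambda_M$ are $$\frac1{\delta(\lambda_\alpha)}=\prod_{\beta\ne\alpha}\frac{\sinh(\lambda_\alpha-\lambda_\beta+\eta)}{\sinh(\lambda_\alpha-\lambda_\beta-\eta)}\qquad(\alpha=1,\dots,M);$$ a solution is understood to have no vanishing denominator in these equations. Let $\{\lambda_\alpha\}_M$ be a solution of the spin-$\ell/2$ equations, $\delta(\lambda)=\prod_{k=1}^{N_s}\frac{\sinh(\lambda-\xi_k)}{\sinh(\lambda-\xi_k+\ell\eta)}$. Let $E\subseteq\mathbb C$ have $0$ as an accumulation point (for instance $E=\mathbb C$ or $E=(0,1)$). For all sufficiently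 small $\epsilon\in E\setminus\{0\}$ let $\{\lambda_\alpha(\epsilon)\}_M$ be a solution, with roots pairwise distinct modulo $\pi i$, of the spin-$1/2$ equations, $\delta(\lambda)=\prod_{j=1}^L b(\lambda-w_j^{(\ell;\epsilon)})$. Assume that $\lambda_\alpha(\epsilon)\to\lambda_\alpha$ for every $\alpha$ as $\epsilon\to0$ in $E\setminus\{0\}$. Let $\mu_1,\dots,\mu_N$ be arbitrary parameters, except that no $\mu_\alpha$ and no $\lambda_\beta$ lies in $w_j^{(\ell)}-\eta+\pi i\mathbb Z$ for any $j=1,\dots,L$. *Claim.* For all $\varepsilon_k,\varepsilon'_k\in\{0,1\}$ ($1\le k\le\ell$) the limit on the right-hand side exists (as $\epsilon\to0$ in $E\setminus\{0\}$), and $$\langle0|\prod_{\alpha=1}^N C^{(0)}(\mu_\alpha)\; e_1^{\varepsilon'_1,\varepsilon_1}\cdots e_\ell^{\varepsilon'_\ell,\varepsilon_\ell}\,\prod_{\beta=1}^M B^{(0)}(\lambda_\beta)|0\rangle$$ $$=\phi_\ell\cdot\lim_{\epsilon\to0}\langle0|\prod_{\alpha=1}^N C^{(\epsilon)}(\mu_\alpha)\;T^{(\epsilon)}_{\varepsilon_1,\varepsilon'_1}(w_1^{(\ell;\epsilon)})\cdots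 T^{(\epsilon)}_{\varepsilon_\ell,\varepsilon'_\ell}(w_\ell^{(\ell;\epsilon)})\prod_{\beta=1}^M B^{(\epsilon)}(\lambda_\beta(\epsilon))|0\rangle,$$ where $\phi_\ell=\phi_\ell(\{\lambda_\beta\};\{w_j^{(\ell)}\})=\prod_{j=1}^{\ell}\prod_{\alpha=1}^M b(\lambda_\alpha-w_j^{(\ell)})$. -/

import Mathlib

open scoped Topology
open Filter

/-! The spin-1/2 inhomogeneous XXZ chain with the symmetric (principal grading) `R`-matrix,
and its specialization to (almost) complete `ℓ`-strings of inhomogeneities. -/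

namespace XXZ

/-- `b(u) = sinh u / sinh (u + η)`. -/
noncomputable def b (η u : ℂ) : ℂ := Complex.sinh u / Complex.sinh (u + η)

/-- `c(u) = sinh η / sinh (u + η)`. -/
noncomputable def c (η u : ℂ) : ℂ := Complex.sinh η / Complex.sinh (u + η)

/-- The symmetric `R`-matrix on `ℂ² ⊗ ℂ²`; the entry at row `(a₁, a₂)` and column `(b₁, b₂)` is
the coefficient of `e^{a₁,b₁} ⊗ e^{a₂,b₂}`. The rows in the basis `00, 01, 10, 11` are
`(1,0,0,0)`, `(0,b,c,0)`, `(0,c,b,0)`, `(0,0,0,1)`. -/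
noncomputable def R (η u : ℂ) : Matrix (Fin 2 × Fin 2) (Fin 2 × Fin 2) ℂ := fun p q =>
  if p = q then (if p.1 = p.2 then 1 else b η u)
  else if p = q.swap then c η u
  else 0

/-- Operators on `(ℂ²)^{⊗ L}`, as matrices in the product basis; a basis vector is a map that gives
for each site its spin (`0` is up, `1` is down). -/
abbrev Op (L : ℕ) : Type := Matrix (Fin L → Fin 2) (Fin L → Fin 2) ℂ

/-- The elementary operator `e_j^{a,b}`: the matrix unit `e^{a,b}` at site `j`, the identity at
every other site. -/
def e {L : ℕ} (j : Fin L) (a b : Fin 2) : Op L := fun s t =>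
  if s j = a ∧ t j = b ∧ ∀ i, i ≠ j → s i = t i then 1 else 0

/-- `R_{0j}(u) = ∑ R(u)^{(a,b),(a',b')} e_0^{a,a'} e_j^{b,b'}`, written as a 2 × 2 matrix in the
auxiliary space `0` whose entries are operators on the chain. -/
noncomputable def R0 {L : ℕ} (η : ℂ) (j : Fin L) (u : ℂ) : Matrix (Fin 2) (Fin 2) (Op L) :=
  fun a a' => ∑ x : Fin 2, ∑ y : Fin 2, R η u (a, x) (a', y) • e j x y

/-- The monodromy matrix `T(λ; {w}) = R_{0L}(λ - w_L) ⋯ R_{01}(λ - w_1)`. -/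
noncomputable def T {L : ℕ} (η : ℂ) (w : Fin L → ℂ) (lam : ℂ) : Matrix (Fin 2) (Fin 2) (Op L) :=
  ((List.ofFn fun j : Fin L => R0 η j (lam - w j)).reverse).prod

/-- The operator `B(λ) = T_{0,1}(λ)`. -/
noncomputable def B {L : ℕ} (η : ℂ) (w : Fin L → ℂ) (lam : ℂ) : Op L := T η w lam 0 1

/-- The operator `C(λ) = T_{1,0}(λ)`. -/
noncomputable def C {L : ℕ} (η : ℂ) (w : Fin L → ℂ) (lam : ℂ) : Op L := T η w lam 1 0

/-- The vacuum matrix element `⟨0| X |0⟩`, where `|0⟩` has all spins up. -/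
def vev {L : ℕ} (X : Op L) : ℂ := X (fun _ => 0) (fun _ => 0)

/-- `⟨0| ∏_α C(μ_α) · X · ∏_β B(λ_β) |0⟩` for the chain with inhomogeneities `w`. -/
noncomputable def matrixElement {L N M : ℕ} (η : ℂ) (w : Fin L → ℂ) (mu : Fin N → ℂ) (X : Op L)
    (lam : Fin M → ℂ) : ℂ :=
  vev ((List.ofFn fun α => C η w (mu α)).prod * X * (List.ofFn fun β => B η w (lam β)).prod)

/-- `d(λ; {w}) = ∏_j b(λ - w_j)`. -/
noncomputable def d {L : ℕ} (η : ℂ) (w : Fin L → ℂ) (lam : ℂ) : ℂ := ∏ j, b η (lam - w j)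

/-- `d^{(ℓ)}(λ; {ξ}) = ∏_k sinh (λ - ξ_k) / sinh (λ - ξ_k + ℓ η)`. -/
noncomputable def dSpin {Ns : ℕ} (ℓ : ℕ) (η : ℂ) (ξ : Fin Ns → ℂ) (lam : ℂ) : ℂ :=
  ∏ k, Complex.sinh (lam - ξ k) / Complex.sinh (lam - ξ k + ℓ * η)

/-- `lam` solves the Bethe-ansatz equations
`1 / δ(λ_α) = ∏_{β ≠ α} sinh (λ_α - λ_β + η) / sinh (λ_α - λ_β - η)`, where no denominator of these
equations vanishes. -/
def SolvesBAE {M : ℕ} (η : ℂ) (δ : ℂ → ℂ) (lam : Fin M → ℂ) : Prop :=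
  ∀ α, δ (lam α) ≠ 0 ∧
    (∀ β, β ≠ α → Complex.sinh (lam α - lam β - η) ≠ 0) ∧
    1 / δ (lam α) = ∏ β ∈ Finset.univ.erase α,
      Complex.sinh (lam α - lam β + η) / Complex.sinh (lam α - lam β - η)

/-- `Ns` almost complete `ℓ`-strings: site number `ℓ (b - 1) + β` (with `1 ≤ b ≤ Ns` and
`1 ≤ β ≤ ℓ`) carries `ξ_b - (β - 1) η + ε r_b^{(β)}`. Here indices start at zero. For `ε = 0`
the strings are complete. -/
noncomputable def string {Ns ℓ : ℕ} (η : ℂ) (ξ : Fin Ns → ℂ) (r : Fin Ns → Fin ℓ → ℂ) (ε : ℂ) :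
    Fin (Ns * ℓ) → ℂ :=
  fun j => ξ j.divNat - (j.modNat : ℕ) * η + ε * r j.divNat j.modNat

/-- The `k`-th site of the first string, for `1 ≤ k ≤ ℓ`; it is the `k`-th site of the chain. -/
def site {Ns ℓ : ℕ} [NeZero Ns] (k : Fin ℓ) : Fin (Ns * ℓ) := finProdFinEquiv ((0 : Fin Ns), k)

/-- `φ_m({λ}; {v}) = ∏_{j=1}^m ∏_α b(λ_α - v_j)`. -/
noncomputable def phi {m M : ℕ} (η : ℂ) (lam : Fin M → ℂ) (v : Fin m → ℂ) : ℂ :=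
  ∏ j, ∏ α, b η (lam α - v j)

end XXZ

/-! Inside a complete string neighbouring inhomogeneities differ by `η`, so `T(w_k)` can meet a pole
of `R` and the inverse problem is not available at `ε = 0` itself. For small `ε ≠ 0` the distinct
`r` keep every `w_i - w_j + η` off the zeros of `sinh` (`eventually_string_sub_ne`), and the
exchange relations hold at all the points `w_k`.

Since `R(0)` is the permutation, `T_{a,a'}(w_1) = e_1^{a',a} t(w_1)` with `t = A + D`, and commuting
`t(w_1)` past a monodromy matrix moves site 1 to the other end of the chain. Iteration gives `e_1 ⋯
e_ℓ t(w_1) ⋯ t(w_ℓ) = T(w_1) ⋯ T(w_ℓ)` (`prod_e_mul_prod_transfer`), without inverting any transfer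
matrix. The algebraic Bethe ansatz (`transfer_mul_bethe`) evaluates each `t(w_k)` on the Bethe
vector as `∏ b(λ_β - w_k)⁻¹`, so the two matrix elements differ by the factor `φ_ℓ`
(`matrixElement_eq`).

The side with local operators has no pole at `ε = 0`, so it converges by continuity
(`tendsto_matrixElement`, `tendsto_phi`). The factor `φ_ℓ` is nonzero in the limit because `δ(λ_β) ≠
0` (`sinh_sub_string_ne_zero`). -/

namespace XXZ

/-! ### Hyperbolic identities; the first also drives the off-shell Bethe computation. -/

section Sinh

open Complex

/- Three instances of the addition theorem of `sinh`, used in the Yang-Baxter equation. -/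

lemma sinh_exchange_sub (u v η : ℂ) :
    sinh (u - v + η) * sinh u = sinh (u + η) * sinh (u - v) + sinh η * sinh v := by
  simp only [sinh_add, sinh_sub, cosh_sub]
  linear_combination sinh η * sinh v * cosh_sq_sub_sinh_sq u

lemma sinh_exchange_add (u v η : ℂ) :
    sinh (u - v + η) * sinh (v + η) = sinh η * sinh (u + η) + sinh (u - v) * sinh v := by
  simp only [sinh_add, sinh_sub, cosh_sub]
  linear_combination (sinh u * sinh v * cosh v - cosh u * sinh v ^ 2) * cosh_sq_sub_sinh_sq η +
    (cosh η * sinh η * sinh u + sinh η ^ 2 * cosh u) * cosh_sq_sub_sinh_sq v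

lemma sinh_exchange_mul (u v η : ℂ) :
    sinh u * sinh (v + η) = sinh (u + η) * sinh v + sinh η * sinh (u - v) := by
  simp only [sinh_add, sinh_sub]
  ring

end Sinh

/-! ### Exchange relations over an abstract operator algebra. -/

section Intertwining

variable {𝒜 : Type*} [Ring 𝒜]

/-- The matrix `R(u)` multiplied by `sinh (u + η)`, which has no poles. -/
noncomputable def weight (η u : ℂ) : Matrix (Fin 2 × Fin 2) (Fin 2 × Fin 2) ℂ := fun p q =>
  if p = q then (if p.1 = p.2 then Complex.sinh (u + η) else Complex.sinh u)
  else if p = q.swap then Complex.sinh η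
  else 0

lemma weight_eq {η u : ℂ} (h : Complex.sinh (u + η) ≠ 0) (p q : Fin 2 × Fin 2) :
    weight η u p q = Complex.sinh (u + η) * R η u p q := by
  unfold weight R b c
  split_ifs <;> field_simp
  simp

/-- The product `X₁ Y₂` of two matrices acting in different auxiliary spaces. -/
def kronL (X Y : Matrix (Fin 2) (Fin 2) 𝒜) : Matrix (Fin 2 × Fin 2) (Fin 2 × Fin 2) 𝒜 :=
  fun p q => X p.1 q.1 * Y p.2 q.2

/-- The product `Y₂ X₁` of two matrices acting in different auxiliary spaces. -/
def kronR (X Y : Matrix (Fin 2) (Fin 2) 𝒜) : Matrix (Fin 2 × Fin 2) (Fin 2 × Fin 2) 𝒜 :=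
  fun p q => Y p.2 q.2 * X p.1 q.1

lemma kronL_mul {X X' Y Y' : Matrix (Fin 2) (Fin 2) 𝒜}
    (h : ∀ a b c d, Commute (X' a b) (Y c d)) :
    kronL (X * X') (Y * Y') = kronL X Y * kronL X' Y' := by
  ext p q
  simp only [kronL, Matrix.mul_apply, Fintype.sum_prod_type, Finset.sum_mul_sum]
  refine Finset.sum_congr rfl fun i _ => Finset.sum_congr rfl fun k _ => ?_
  rw [mul_assoc, mul_assoc, ← mul_assoc (X' _ _), (h _ _ _ _).eq, mul_assoc]

lemma kronR_mul {X X' Y Y' : Matrix (Fin 2) (Fin 2) 𝒜}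
    (h : ∀ a b c d, Commute (X a b) (Y' c d)) :
    kronR (X * X') (Y * Y') = kronR X Y * kronR X' Y' := by
  ext p q
  simp only [kronR, Matrix.mul_apply, Fintype.sum_prod_type, Finset.sum_mul_sum]
  rw [Finset.sum_comm]
  refine Finset.sum_congr rfl fun i _ => Finset.sum_congr rfl fun k _ => ?_
  rw [mul_assoc, mul_assoc, ← mul_assoc (Y' _ _), ← (h _ _ _ _).eq, mul_assoc]

variable [Algebra ℂ 𝒜]

/-- The relation `r X₁ Y₂ = Y₂ X₁ r`. -/
def Intertwines (r : Matrix (Fin 2 × Fin 2) (Fin 2 × Fin 2) ℂ) (X Y : Matrix (Fin 2) (Fin 2) 𝒜) :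
    Prop :=
  r.map (algebraMap ℂ 𝒜) * kronL X Y = kronR X Y * r.map (algebraMap ℂ 𝒜)

/-- Ultralocality: entries belonging to different sites commute, so `r` passes through the product
one factor at a time. -/
lemma Intertwines.mul {r : Matrix (Fin 2 × Fin 2) (Fin 2 × Fin 2) ℂ}
    {X X' Y Y' : Matrix (Fin 2) (Fin 2) 𝒜} (h : Intertwines r X Y) (h' : Intertwines r X' Y')
    (hc : ∀ a b c d, Commute (X' a b) (Y c d)) (hc' : ∀ a b c d, Commute (X a b) (Y' c d)) :
    Intertwines r (X * X') (Y * Y') := by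
  unfold Intertwines at *
  rw [kronL_mul hc, kronR_mul hc', ← mul_assoc, h, mul_assoc, h', mul_assoc]

lemma intertwines_one (r : Matrix (Fin 2 × Fin 2) (Fin 2 × Fin 2) ℂ) :
    Intertwines r (1 : Matrix (Fin 2) (Fin 2) 𝒜) 1 := by
  have h1 : kronL (1 : Matrix (Fin 2) (Fin 2) 𝒜) 1 = 1 := by
    ext ⟨a, b⟩ ⟨a', b'⟩
    simp only [kronL, Matrix.one_apply, Prod.mk.injEq]
    split_ifs <;> simp_all
  have h2 : kronR (1 : Matrix (Fin 2) (Fin 2) 𝒜) 1 = 1 := by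
    ext ⟨a, b⟩ ⟨a', b'⟩
    simp only [kronR, Matrix.one_apply, Prod.mk.injEq]
    split_ifs <;> simp_all
  rw [Intertwines, h1, h2, mul_one, one_mul]

lemma Intertwines.apply {r : Matrix (Fin 2 × Fin 2) (Fin 2 × Fin 2) ℂ}
    {X Y : Matrix (Fin 2) (Fin 2) 𝒜} (h : Intertwines r X Y) (a₁ a₂ b₁ b₂ : Fin 2) :
    ∑ c₁, ∑ c₂, r (a₁, a₂) (c₁, c₂) • (X c₁ b₁ * Y c₂ b₂) =
      ∑ c₁, ∑ c₂, r (c₁, c₂) (b₁, b₂) • (Y a₂ c₂ * X a₁ c₁) := by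
  have := congrFun (congrFun h (a₁, a₂)) (b₁, b₂)
  simpa only [Matrix.mul_apply, Matrix.map_apply, kronL, kronR, Fintype.sum_prod_type,
    ← Algebra.commutes (R := ℂ), ← Algebra.smul_def] using this

end Intertwining

/-! ### Local operators and the Yang-Baxter equation at one site. -/

section Site

variable {L : ℕ}

lemma e_mul_e_self (j : Fin L) (a b a' b' : Fin 2) :
    e j a b * e j a' b' = if b = a' then e j a b' else 0 := by
  ext s t
  -- The only intermediate state that can contribute is `s` with its spin at `j` replaced by `b`.
  rw [Matrix.mul_apply, Finset.sum_eq_single (Function.update s j b)]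
  · by_cases hb : b = a'
    · subst hb
      simp only [e, Function.update_self, true_and, if_true]
      rw [ite_zero_mul_ite_zero, one_mul]
      refine if_congr ?_ rfl rfl
      have h : ∀ i, i ≠ j → Function.update s j b i = s i := fun i hi =>
        Function.update_of_ne hi _ _
      constructor
      · rintro ⟨⟨h1, -⟩, h2, h3⟩
        exact ⟨h1, h2, fun i hi => by rw [← h3 i hi, h i hi]⟩
      · rintro ⟨h1, h2, h3⟩
        exact ⟨⟨h1, fun i hi => (h i hi).symm⟩, h2, fun i hi => by rw [h i hi, h3 i hi]⟩
    · simp [e, hb]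
  · intro x _ hx
    simp only [e]
    rw [if_neg, zero_mul]
    rintro ⟨-, h1, h2⟩
    apply hx
    ext1 i
    by_cases hi : i = j
    · subst hi; simp [h1]
    · rw [Function.update_of_ne hi, h2 i hi]
  · simp

/-- The condition is symmetric under exchange of the two sites, which yields `commute_e`. -/
lemma e_mul_e_apply {i j : Fin L} (hij : i ≠ j) (a b a' b' : Fin 2) (s t : Fin L → Fin 2) :
    (e i a b * e j a' b' : Op L) s t =
      if s i = a ∧ t i = b ∧ s j = a' ∧ t j = b' ∧ ∀ k, k ≠ i → k ≠ j → s k = t k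
        then 1 else 0 := by
  rw [Matrix.mul_apply, Finset.sum_eq_single (Function.update s i (t i))]
  · simp only [e]
    rw [ite_zero_mul_ite_zero, one_mul]
    refine if_congr ?_ rfl rfl
    simp only [Function.update_self, Function.update_of_ne hij.symm]
    constructor
    · rintro ⟨⟨h1, h2, -⟩, h4, h5, h6⟩
      refine ⟨h1, h2, h4, h5, fun k hki hkj => ?_⟩
      rw [← h6 k hkj, Function.update_of_ne hki]
    · rintro ⟨h1, h2, h3, h4, h5⟩
      refine ⟨⟨h1, h2, fun k hk => by rw [Function.update_of_ne hk]⟩, h3, h4, fun k hk => ?_⟩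
      by_cases hki : k = i
      · subst hki; simp
      · rw [Function.update_of_ne hki, h5 k hki hk]
  · intro x _ hx
    simp only [e]
    rw [ite_zero_mul_ite_zero, if_neg]
    rintro ⟨⟨-, -, h1⟩, -, -, h2⟩
    apply hx
    ext1 k
    by_cases hk : k = i
    · subst hk; simp [h2 k hij]
    · rw [Function.update_of_ne hk, h1 k hk]
  · simp

lemma commute_e {i j : Fin L} (hij : i ≠ j) (a b a' b' : Fin 2) :
    Commute (e i a b) (e j a' b') := by
  ext s t
  rw [e_mul_e_apply hij, e_mul_e_apply hij.symm]
  refine if_congr ?_ rfl rfl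
  constructor <;> rintro ⟨h1, h2, h3, h4, h5⟩ <;> exact ⟨h3, h4, h1, h2, fun k h h' => h5 k h' h⟩

/-- With `R0_mul_e`, this lets site `j` serve as a second auxiliary space: its operators become
scalar entries of `R` times matrix units. -/
lemma e_mul_R0 (η : ℂ) (j : Fin L) (u : ℂ) (x y p a : Fin 2) :
    e j x y * R0 η j u p a = ∑ q, R η u (p, y) (a, q) • e j x q := by
  simp only [R0, Finset.mul_sum, mul_smul_comm, e_mul_e_self, smul_ite, smul_zero]
  rw [Finset.sum_comm]
  simp

lemma R0_mul_e (η : ℂ) (j : Fin L) (u : ℂ) (a p y q : Fin 2) :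
    R0 η j u a p * e j y q = ∑ x, R η u (a, x) (p, y) • e j x q := by
  simp only [R0, Finset.sum_mul, smul_mul_assoc, e_mul_e_self, smul_ite, smul_zero]
  simp

lemma commute_R0 {i j : Fin L} (hij : i ≠ j) (η u v : ℂ) (a b a' b' : Fin 2) :
    Commute (R0 η i u a b) (R0 η j v a' b') := by
  unfold R0
  refine Commute.sum_left _ _ _ fun x _ => Commute.sum_left _ _ _ fun y _ =>
    Commute.sum_right _ _ _ fun x' _ => Commute.sum_right _ _ _ fun y' _ => ?_
  exact ((commute_e hij _ _ _ _).smul_left _).smul_right _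

lemma commute_e_R0 {i j : Fin L} (hij : i ≠ j) (η v : ℂ) (a b a' b' : Fin 2) :
    Commute (e i a b) (R0 η j v a' b') := by
  unfold R0
  refine Commute.sum_right _ _ _ fun x' _ => Commute.sum_right _ _ _ fun y' _ => ?_
  exact (commute_e hij _ _ _ _).smul_right _

lemma R0_zero_zero (η : ℂ) (j : Fin L) (u : ℂ) : R0 η j u 0 0 = e j 0 0 + b η u • e j 1 1 := by
  simp [R0, R]

lemma R0_zero_one (η : ℂ) (j : Fin L) (u : ℂ) : R0 η j u 0 1 = c η u • e j 1 0 := by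
  simp [R0, R]

lemma R0_one_zero (η : ℂ) (j : Fin L) (u : ℂ) : R0 η j u 1 0 = c η u • e j 0 1 := by
  simp [R0, R]

lemma R0_one_one (η : ℂ) (j : Fin L) (u : ℂ) : R0 η j u 1 1 = b η u • e j 0 0 + e j 1 1 := by
  simp [R0, R]

/-- The `R`-matrix at `u = 0` is the permutation. -/
lemma R0_at_zero {η : ℂ} (hη : Complex.sinh η ≠ 0) (j : Fin L) (a a' : Fin 2) :
    R0 η j 0 a a' = e j a' a := by
  fin_cases a <;> fin_cases a' <;>
    simp [R0_zero_zero, R0_zero_one, R0_one_zero, R0_one_one, b, c, hη]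

/-- A check of the 16 entries, expanded in the matrix units at `j`. Using `weight` instead of `R`
leaves no condition on `u - v`. -/
lemma intertwines_R0 (η : ℂ) (j : Fin L) {u v : ℂ} (hu : Complex.sinh (u + η) ≠ 0)
    (hv : Complex.sinh (v + η) ≠ 0) :
    Intertwines (weight η (u - v)) (R0 η j u) (R0 η j v) := by
  have key : ∀ a₁ a₂ b₁ b₂ : Fin 2,
    ∑ c₁, ∑ c₂, weight η (u - v) (a₁, a₂) (c₁, c₂) • (R0 η j u c₁ b₁ * R0 η j v c₂ b₂) =
      ∑ c₁, ∑ c₂, weight η (u - v) (c₁, c₂) (b₁, b₂) • (R0 η j v a₂ c₂ * R0 η j u a₁ c₁) := by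
    intro a₁ a₂ b₁ b₂
    have h1 := sinh_exchange_sub u v η
    have h2 := sinh_exchange_add u v η
    have h3 := sinh_exchange_mul u v η
    fin_cases a₁ <;> fin_cases a₂ <;> fin_cases b₁ <;> fin_cases b₂ <;>
      simp [weight, R0_zero_zero, R0_zero_one, R0_one_zero, R0_one_one, add_mul, mul_add,
        e_mul_e_self, smul_smul] <;>
      match_scalars <;> simp only [b, c] <;> field_simp <;>
      first
        | linear_combination Complex.sinh η * h1
        | linear_combination -Complex.sinh η * h1
        | linear_combination Complex.sinh η * h2
        | linear_combination -Complex.sinh η * h2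
        | linear_combination Complex.sinh η * h3
        | linear_combination -Complex.sinh η * h3
  refine Matrix.ext fun ⟨a₁, a₂⟩ ⟨b₁, b₂⟩ => ?_
  simpa only [Matrix.mul_apply, Matrix.map_apply, kronL, kronR, Fintype.sum_prod_type,
    ← Algebra.commutes (R := ℂ), ← Algebra.smul_def] using key a₁ a₂ b₁ b₂

end Site

/-! ### Monodromy and transfer matrices, and the inverse problem. -/

section Monodromy

variable {L : ℕ}

/-- The product of the matrices `R_{0j}(λ - w_j)` over a list of sites. -/
noncomputable def monodromy (η : ℂ) (w : Fin L → ℂ) (l : List (Fin L)) (lam : ℂ) :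
    Matrix (Fin 2) (Fin 2) (Op L) :=
  (l.map fun j => R0 η j (lam - w j)).prod

lemma T_eq_monodromy (η : ℂ) (w : Fin L → ℂ) (lam : ℂ) :
    T η w lam = monodromy η w (List.finRange L).reverse lam := by
  rw [T, monodromy, List.ofFn_eq_map, List.map_reverse]

lemma monodromy_nil (η : ℂ) (w : Fin L → ℂ) (lam : ℂ) : monodromy η w [] lam = 1 := rfl

lemma monodromy_cons (η : ℂ) (w : Fin L → ℂ) (j : Fin L) (l : List (Fin L)) (lam : ℂ) :
    monodromy η w (j :: l) lam = R0 η j (lam - w j) * monodromy η w l lam := by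
  simp [monodromy]

lemma monodromy_concat (η : ℂ) (w : Fin L → ℂ) (j : Fin L) (l : List (Fin L)) (lam : ℂ) :
    monodromy η w (l ++ [j]) lam = monodromy η w l lam * R0 η j (lam - w j) := by
  simp [monodromy]

/-- An operator that commutes with the `R`-matrices of all sites in `l` commutes with the entries
of the monodromy matrix of `l`. -/
lemma commute_monodromy {η : ℂ} {w : Fin L → ℂ} {l : List (Fin L)} {lam : ℂ} {X : Op L}
    (h : ∀ j ∈ l, ∀ a b, Commute X (R0 η j (lam - w j) a b)) (a b : Fin 2) :
    Commute X (monodromy η w l lam a b) := by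
  induction l generalizing a b with
  | nil =>
    rw [monodromy_nil, Matrix.one_apply]
    split_ifs
    · exact Commute.one_right X
    · exact Commute.zero_right X
  | cons j l ih =>
    rw [monodromy_cons, Matrix.mul_apply]
    exact Commute.sum_right _ _ _ fun x _ => (h j List.mem_cons_self a x).mul_right
      (ih (fun i hi => h i (List.mem_cons_of_mem j hi)) x b)

lemma commute_e_monodromy (η : ℂ) (w : Fin L → ℂ) {l : List (Fin L)} {j : Fin L} (hj : j ∉ l)
    (lam : ℂ) (a b a' b' : Fin 2) : Commute (e j a b) (monodromy η w l lam a' b') :=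
  commute_monodromy (fun _ hi _ _ => commute_e_R0 (fun h => hj (by rwa [h])) _ _ _ _ _ _) _ _

lemma commute_R0_monodromy (η : ℂ) (w : Fin L → ℂ) {l : List (Fin L)} {j : Fin L} (hj : j ∉ l)
    (u lam : ℂ) (a b a' b' : Fin 2) : Commute (R0 η j u a b) (monodromy η w l lam a' b') :=
  commute_monodromy (fun _ hi _ _ => commute_R0 (fun h => hj (by rwa [h])) _ _ _ _ _ _ _) _ _

/-- The exchange relations `R₁₂(λ - μ) T₁(λ) T₂(μ) = T₂(μ) T₁(λ) R₁₂(λ - μ)`. -/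
lemma intertwines_monodromy (η : ℂ) (w : Fin L → ℂ) {l : List (Fin L)} (hl : l.Nodup)
    {lam mu : ℂ} (hlam : ∀ j ∈ l, Complex.sinh (lam - w j + η) ≠ 0)
    (hmu : ∀ j ∈ l, Complex.sinh (mu - w j + η) ≠ 0) :
    Intertwines (weight η (lam - mu)) (monodromy η w l lam) (monodromy η w l mu) := by
  induction l with
  | nil => exact intertwines_one _
  | cons j l ih =>
    rw [List.nodup_cons] at hl
    simp only [List.mem_cons, forall_eq_or_imp] at hlam hmu
    rw [monodromy_cons, monodromy_cons]
    refine Intertwines.mul ?_ (ih hl.2 hlam.2 hmu.2)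
      (fun _ _ _ _ => (commute_R0_monodromy η w hl.1 _ _ _ _ _ _).symm)
      (fun _ _ _ _ => commute_R0_monodromy η w hl.1 _ _ _ _ _ _)
    rw [show lam - mu = (lam - w j) - (mu - w j) by ring]
    exact intertwines_R0 η j hlam.1 hmu.1

/-- The transfer matrix `A(λ) + D(λ)` of a list of sites. -/
noncomputable def transfer (η : ℂ) (w : Fin L → ℂ) (l : List (Fin L)) (lam : ℂ) : Op L :=
  monodromy η w l lam 0 0 + monodromy η w l lam 1 1

lemma transfer_eq_sum {η : ℂ} (hη : Complex.sinh η ≠ 0) (w : Fin L → ℂ) (l : List (Fin L))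
    (j : Fin L) :
    transfer η w (l ++ [j]) (w j) =
      ∑ x : Fin 2, ∑ y : Fin 2, monodromy η w l (w j) x y * e j x y := by
  simp [transfer, monodromy_concat, Matrix.mul_apply, R0_at_zero hη]

/-- At `λ = w_j`, where `j` is the rightmost site, the entries of the monodromy matrix are the
local operators at `j` times the transfer matrix. -/
lemma monodromy_at_site {η : ℂ} (hη : Complex.sinh η ≠ 0) (w : Fin L → ℂ) {l : List (Fin L)}
    {j : Fin L} (hj : j ∉ l) (a a' : Fin 2) :
    monodromy η w (l ++ [j]) (w j) a a' = e j a' a * transfer η w (l ++ [j]) (w j) := by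
  have hc := fun x y => commute_e_monodromy η w hj (w j) a' a x y
  have hs : ∀ x y, e j a' a * (monodromy η w l (w j) x y * e j x y) =
      if a = x then monodromy η w l (w j) a y * e j a' y else 0 := by
    intro x y
    rw [← mul_assoc, (hc x y).eq, mul_assoc, e_mul_e_self]
    split_ifs with h
    · rw [h]
    · rw [mul_zero]
  rw [transfer_eq_sum hη, monodromy_concat, Matrix.mul_apply]
  simp only [sub_self, R0_at_zero hη, Finset.mul_sum, hs]
  rw [Finset.sum_comm]
  simp

/-- Commuting with the transfer matrix at `λ = w_j`, where `j` is the rightmost site, moves `j` to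
the leftmost position of the monodromy matrix. -/
lemma transfer_mul_monodromy {η : ℂ} (hη : Complex.sinh η ≠ 0) (w : Fin L → ℂ)
    {l : List (Fin L)} {j : Fin L} (hl : (l ++ [j]).Nodup) {lam : ℂ}
    (hw : ∀ i ∈ l, Complex.sinh (w j - w i + η) ≠ 0)
    (hlam : ∀ i ∈ l, Complex.sinh (lam - w i + η) ≠ 0)
    (hj : Complex.sinh (lam - w j + η) ≠ 0) (a a' : Fin 2) :
    transfer η w (l ++ [j]) (w j) * monodromy η w (l ++ [j]) lam a a' =
      monodromy η w (j :: l) lam a a' * transfer η w (l ++ [j]) (w j) := by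
  obtain ⟨hnd, -, hd⟩ := List.nodup_append.1 hl
  have hjl : j ∉ l := fun h => hd j h j (by simp) rfl
  -- Both sides of the goal will be expanded in `e_j^{x,q}`. Their coefficients agree by the
  -- exchange relation for the remaining sites `l`, where the `R`-matrix of site `j` itself plays
  -- the intertwiner.
  have hRTT : ∀ x q,
      ∑ y, ∑ p, R η (lam - w j) (p, y) (a', q) • (monodromy η w l (w j) x y *
        monodromy η w l lam a p) =
      ∑ y, ∑ p, R η (lam - w j) (a, x) (p, y) • (monodromy η w l lam p a' *
        monodromy η w l (w j) y q) := by
    intro x q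
    have h := (intertwines_monodromy η w hnd hlam hw).apply a x a' q
    simp only [weight_eq hj, mul_smul, ← Finset.smul_sum] at h
    have h := smul_right_injective _ hj h
    rw [Finset.sum_comm, ← h, Finset.sum_comm]
  have hc := fun p q x y => commute_e_monodromy η w hjl lam p q x y
  have hcR := fun p q x y => commute_R0_monodromy η w hjl (lam - w j) lam p q x y
  have hcR' := fun p q x y => commute_R0_monodromy η w hjl (lam - w j) (w j) p q x y
  have hleft : transfer η w (l ++ [j]) (w j) * monodromy η w (l ++ [j]) lam a a' =
      ∑ x, ∑ q, (∑ y, ∑ p, R η (lam - w j) (p, y) (a', q) • (monodromy η w l (w j) x y *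
        monodromy η w l lam a p)) * e j x q := by
    have hs : ∀ x y p, monodromy η w l (w j) x y * e j x y *
        (monodromy η w l lam a p * R0 η j (lam - w j) p a') =
        ∑ q, (R η (lam - w j) (p, y) (a', q) • (monodromy η w l (w j) x y *
          monodromy η w l lam a p)) * e j x q := by
      intro x y p
      rw [mul_assoc, ← mul_assoc (e j x y), (hc x y a p).eq, mul_assoc, e_mul_R0]
      simp only [Finset.mul_sum, mul_smul_comm, smul_mul_assoc, mul_assoc]
    rw [transfer_eq_sum hη, monodromy_concat, Matrix.mul_apply]
    simp only [Finset.sum_mul, Finset.mul_sum, hs]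
    simp only [Fin.sum_univ_two]
    abel
  have hright : monodromy η w (j :: l) lam a a' * transfer η w (l ++ [j]) (w j) =
      ∑ x, ∑ q, (∑ y, ∑ p, R η (lam - w j) (a, x) (p, y) • (monodromy η w l lam p a' *
        monodromy η w l (w j) y q)) * e j x q := by
    have hs : ∀ p y q, R0 η j (lam - w j) a p * monodromy η w l lam p a' *
        (monodromy η w l (w j) y q * e j y q) =
        ∑ x, (R η (lam - w j) (a, x) (p, y) • (monodromy η w l lam p a' *
          monodromy η w l (w j) y q)) * e j x q := by
      intro p y q
      rw [(hcR a p p a').eq, mul_assoc, ← mul_assoc (R0 η j _ a p), (hcR' a p y q).eq, mul_assoc,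
        R0_mul_e]
      simp only [Finset.mul_sum, mul_smul_comm, smul_mul_assoc, mul_assoc]
    rw [transfer_eq_sum hη, monodromy_cons, Matrix.mul_apply]
    simp only [Finset.sum_mul, Finset.mul_sum, hs]
    simp only [Fin.sum_univ_two]
    abel
  rw [hleft, hright]
  exact Finset.sum_congr rfl fun x _ => Finset.sum_congr rfl fun q _ => by rw [hRTT]

lemma mul_prod_map_eq_prod_map_mul {κ A : Type*} [Monoid A] {t : A} {f g : κ → A}
    (h : ∀ k, t * f k = g k * t) (ks : List κ) :
    t * (ks.map f).prod = (ks.map g).prod * t := by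
  induction ks with
  | nil => simp
  | cons k ks ih =>
    rw [List.map_cons, List.prod_cons, List.map_cons, List.prod_cons, ← mul_assoc, h, mul_assoc,
      ih, mul_assoc]

/-- Solution of the inverse problem: products of local operators at the rightmost sites, in terms
of the monodromy matrix. -/
lemma prod_e_mul_prod_transfer {κ : Type*} {η : ℂ} (hη : Complex.sinh η ≠ 0) (w : Fin L → ℂ)
    (hw : ∀ i j, Complex.sinh (w i - w j + η) ≠ 0) (f : κ → Fin L) (s s' : κ → Fin 2)
    (ks : List κ) (p : List (Fin L)) (hnd : (p ++ (ks.map f).reverse).Nodup) :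
    (ks.map fun k => e (f k) (s' k) (s k)).prod *
        (ks.map fun k => transfer η w (p ++ (ks.map f).reverse) (w (f k))).prod =
      (ks.map fun k => monodromy η w (p ++ (ks.map f).reverse) (w (f k)) (s k) (s' k)).prod := by
  induction ks generalizing p with
  | nil => simp
  | cons k ks ih =>
    have hlist : p ++ ((k :: ks).map f).reverse = p ++ (ks.map f).reverse ++ [f k] := by simp
    rw [hlist] at hnd ⊢
    have hj : f k ∉ p ++ (ks.map f).reverse := fun h =>
      (List.nodup_append.1 hnd).2.2 _ h _ (by simp) rfl
    have hnd' : (f k :: p ++ (ks.map f).reverse).Nodup :=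
      List.nodup_cons.2 ⟨hj, (List.nodup_append.1 hnd).1⟩
    have hT := fun i => transfer_mul_monodromy hη w hnd (lam := w (f i))
      (fun _ _ => hw _ _) (fun _ _ => hw _ _) (hw _ _)
    have ht : ∀ i, transfer η w (p ++ (ks.map f).reverse ++ [f k]) (w (f k)) *
        transfer η w (p ++ (ks.map f).reverse ++ [f k]) (w (f i)) =
        transfer η w (f k :: p ++ (ks.map f).reverse) (w (f i)) *
          transfer η w (p ++ (ks.map f).reverse ++ [f k]) (w (f k)) := by
      intro i
      conv_lhs => rw [transfer.eq_1 η w _ (w (f i)), mul_add, hT, hT, ← add_mul]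
      rfl
    -- Moving `t(w_{f k})` to the far right rotates `f k` to the front of every later factor. The
    -- next site is then rightmost, and the induction hypothesis applies with `f k :: p` in place of
    -- `p`.
    have hM := mul_prod_map_eq_prod_map_mul (fun i => hT i (s i) (s' i)) ks
    have hM' := mul_prod_map_eq_prod_map_mul ht ks
    rw [← List.cons_append] at hM
    rw [List.map_cons, List.map_cons, List.map_cons, List.prod_cons, List.prod_cons,
      List.prod_cons, monodromy_at_site hη w hj, mul_assoc, mul_assoc, hM, hM',
      ← ih _ hnd', mul_assoc]

end Monodromy

/-! ### Exchange relations of `A`, `B`, `D` and the off-shell action. -/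

section Bethe

open Complex

variable {𝒜 : Type*} [Ring 𝒜] [Algebra ℂ 𝒜]

lemma Intertwines.B_mul_B {η lam mu : ℂ} {X Y : Matrix (Fin 2) (Fin 2) 𝒜}
    (h : Intertwines (weight η (lam - mu)) X Y) (hs : sinh (lam - mu + η) ≠ 0) :
    Commute (X 0 1) (Y 0 1) := by
  have := h.apply 0 0 1 1
  simp [weight] at this
  exact smul_right_injective _ hs this

lemma Intertwines.A_mul_B {η lam mu : ℂ} {X Y : Matrix (Fin 2) (Fin 2) 𝒜}
    (h : Intertwines (weight η (lam - mu)) X Y) (hs : sinh (lam - mu) ≠ 0) :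
    Y 0 0 * X 0 1 = (sinh (lam - mu + η) / sinh (lam - mu)) • (X 0 1 * Y 0 0) -
      (sinh η / sinh (lam - mu)) • (Y 0 1 * X 0 0) := by
  have := h.apply 0 0 1 0
  simp [weight] at this
  rw [div_eq_inv_mul, div_eq_inv_mul, mul_smul, mul_smul, this, ← smul_sub, add_sub_cancel_left,
    inv_smul_smul₀ hs]

/-- Written with `-η` to match the shape of `A_mul_B`, so that `mul_prod_B` serves both `A` and `D`.
-/
lemma Intertwines.D_mul_B {η lam mu : ℂ} {X Y : Matrix (Fin 2) (Fin 2) 𝒜}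
    (h : Intertwines (weight η (mu - lam)) X Y) (hs : sinh (lam - mu) ≠ 0) :
    X 1 1 * Y 0 1 = (sinh (lam - mu + -η) / sinh (lam - mu)) • (Y 0 1 * X 1 1) -
      (sinh (-η) / sinh (lam - mu)) • (X 0 1 * Y 1 1) := by
  have := h.apply 1 0 1 1
  simp [weight] at this
  rw [show mu - lam + η = -(lam - mu + -η) by ring, ← neg_sub lam mu, sinh_neg, sinh_neg] at this
  have h2 : sinh (lam - mu) • (X 1 1 * Y 0 1) = sinh (lam - mu + -η) • (Y 0 1 * X 1 1) -
      sinh (-η) • (X 0 1 * Y 1 1) := by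
    rw [sinh_neg, eq_sub_iff_add_eq, ← neg_inj, ← neg_smul (sinh (lam - mu + -η)), ← this]
    module
  rw [div_eq_inv_mul, div_eq_inv_mul, mul_smul, mul_smul, ← smul_sub, ← h2, inv_smul_smul₀ hs]

/-- The off-shell action of an operator `X` (`A` or `D`) on a product of `B` operators acting on a
common eigenvector of the operators `X`. -/
lemma mul_prod_B {ι : Type*} [DecidableEq ι] {η : ℂ} {X B : ℂ → 𝒜} {V : 𝒜} {a : ℂ → ℂ}
    {P : ℂ → Prop} (hX : ∀ lam, P lam → X lam * V = a lam • V)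
    (hXB : ∀ lam mu, P lam → P mu → sinh (lam - mu) ≠ 0 →
      X mu * B lam = (sinh (lam - mu + η) / sinh (lam - mu)) • (B lam * X mu) -
        (sinh η / sinh (lam - mu)) • (B mu * X lam))
    {x : ι → ℂ} {β : Finset ι → 𝒜} (hβ0 : β ∅ = 1)
    (hβ : ∀ i S, i ∉ S → β (insert i S) = B (x i) * β S) (hP : ∀ i, P (x i))
    (hx : ∀ i k, i ≠ k → sinh (x i - x k) ≠ 0)
    (hcomm : ∀ i k, Commute (B (x i)) (B (x k))) (S : Finset ι) (mu : ℂ) (hmu : P mu)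
    (hS : ∀ i ∈ S, sinh (x i - mu) ≠ 0) (hcommS : ∀ i ∈ S, Commute (B (x i)) (B mu)) :
    X mu * (β S * V) =
      ((∏ i ∈ S, sinh (x i - mu + η) / sinh (x i - mu)) * a mu) • (β S * V) -
        ∑ k ∈ S, (sinh η / sinh (x k - mu) *
          ((∏ i ∈ S.erase k, sinh (x i - x k + η) / sinh (x i - x k)) * a (x k))) •
            (B mu * (β (S.erase k) * V)) := by
  induction S using Finset.induction_on generalizing mu with
  | empty => simp [hβ0, hX mu hmu]
  | insert o S ho ih =>
    simp only [Finset.mem_insert, forall_eq_or_imp] at hS hcommS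
    have hoS : ∀ k ∈ S, o ≠ k := fun k hk h => ho (h ▸ hk)
    have h1 := ih mu hmu hS.2 hcommS.2
    have h2 := ih (x o) (hP o) (fun i hi => hx _ _ (hoS i hi).symm) (fun i _ => hcomm _ _)
    -- The term omitting `x k` arises in two ways: from `X mu` after passing `B (x o)`, and from `X
    -- (x o)` after an exchange of arguments. `sinh_exchange_sub` merges the two coefficients.
    have hsum : ∑ k ∈ S, (sinh η / sinh (x k - mu) *
          ((∏ i ∈ (insert o S).erase k, sinh (x i - x k + η) / sinh (x i - x k)) * a (x k))) •
            (B mu * (β ((insert o S).erase k) * V)) =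
        (sinh (x o - mu + η) / sinh (x o - mu)) • (B (x o) *
          ∑ k ∈ S, (sinh η / sinh (x k - mu) *
          ((∏ i ∈ S.erase k, sinh (x i - x k + η) / sinh (x i - x k)) * a (x k))) •
            (B mu * (β (S.erase k) * V))) -
        (sinh η / sinh (x o - mu)) • (B mu *
          ∑ k ∈ S, (sinh η / sinh (x k - x o) *
          ((∏ i ∈ S.erase k, sinh (x i - x k + η) / sinh (x i - x k)) * a (x k))) •
            (B (x o) * (β (S.erase k) * V))) := by
      rw [Finset.mul_sum, Finset.mul_sum, Finset.smul_sum, Finset.smul_sum,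
        ← Finset.sum_sub_distrib]
      refine Finset.sum_congr rfl fun k hk => ?_
      have hok : o ∉ S.erase k := fun h => ho (Finset.mem_of_mem_erase h)
      rw [Finset.erase_insert_of_ne (hoS k hk), Finset.prod_insert hok, hβ _ _ hok,
        mul_smul_comm, mul_smul_comm, smul_smul, smul_smul, ← mul_assoc (B (x o)), hcommS.1.eq,
        mul_assoc (B mu), mul_assoc (B (x o)), ← sub_smul]
      congr 1
      have n1 := hS.1
      have n2 := hS.2 k hk
      have n3 := hx o k (hoS k hk)
      rw [← neg_sub (x o) (x k), sinh_neg]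
      have key := sinh_exchange_sub (x o - mu) (x k - mu) η
      rw [sub_sub_sub_cancel_right] at key
      generalize (∏ i ∈ S.erase k, sinh (x i - x k + η) / sinh (x i - x k)) = p
      field_simp
      linear_combination sinh η * p * a (x k) * key
    rw [hβ o S ho, Finset.sum_insert ho, Finset.prod_insert ho, Finset.erase_insert ho, hsum,
      mul_assoc, ← mul_assoc (X mu), hXB (x o) mu (hP o) hmu hS.1, sub_mul, smul_mul_assoc,
      smul_mul_assoc, mul_assoc, mul_assoc, h1, h2, mul_sub, mul_sub, mul_smul_comm,
      mul_smul_comm]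
    module

end Bethe

/-! ### The vacuum, as a projection, so that vectors stay inside the operator algebra. -/

section Vacuum

variable {L : ℕ}

/-- The projection onto the vacuum. -/
def vac (L : ℕ) : Op L := Matrix.single (fun _ => 0) (fun _ => 0) 1

lemma vev_mul_vac (X : Op L) : vev (X * vac L) = vev X := by
  simp [vev, vac]

lemma e_zero_mul_vac (j : Fin L) : e j 0 0 * vac L = vac L := by
  ext s t
  rw [Matrix.mul_apply, Finset.sum_eq_single fun _ => 0]
  · have : (e j 0 0 : Op L) s (fun _ => 0) = if (fun _ => 0) = s then 1 else 0 := by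
      refine if_congr ⟨fun h => funext fun i => ?_, fun h => by simp [← h]⟩ rfl rfl
      by_cases hi : i = j
      · rw [hi, h.1]
      · exact (h.2.2 i hi).symm
    rw [this]
    by_cases h : (fun _ => 0) = s <;> simp [vac, Matrix.single_apply, h]
  · intro x _ hx
    rw [vac, Matrix.single_apply, if_neg (fun h => hx h.1.symm), mul_zero]
  · simp

lemma e_one_mul_vac (j : Fin L) (a : Fin 2) : e j a 1 * vac L = 0 := by
  rw [← e_zero_mul_vac j, ← mul_assoc, e_mul_e_self, if_neg (by decide), zero_mul]

lemma monodromy_mul_vac (η : ℂ) (w : Fin L → ℂ) {l : List (Fin L)} (hl : l.Nodup) (lam : ℂ) :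
    monodromy η w l lam 0 0 * vac L = vac L ∧ monodromy η w l lam 1 0 * vac L = 0 ∧
      monodromy η w l lam 1 1 * vac L = (l.map fun j => b η (lam - w j)).prod • vac L := by
  induction l with
  | nil => simp [monodromy_nil]
  | cons j l ih =>
    rw [List.nodup_cons] at hl
    obtain ⟨h1, h2, h3⟩ := ih hl.2
    -- In the `D` entry the extra term contains `e_j^{0,1}`, which commutes past the other sites and
    -- annihilates the vacuum.
    have h4 := (commute_e_monodromy η w hl.1 lam 0 1 0 1).eq
    simp only [monodromy_cons, Matrix.mul_apply, Fin.sum_univ_two, add_mul, mul_assoc, h1, h2, h3,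
      R0_zero_zero, R0_one_zero, R0_one_one, smul_mul_assoc, e_zero_mul_vac, e_one_mul_vac,
      mul_zero, smul_zero, add_zero, mul_smul_comm, List.map_cons, List.prod_cons, true_and]
    rw [← mul_assoc, h4, mul_assoc, e_one_mul_vac, mul_zero, smul_zero, zero_add, smul_smul,
      mul_comm]

end Vacuum

/-! ### On-shell Bethe vectors and matrix elements. -/

section Eigenvector

open Complex

variable {L M : ℕ}

/-- The Bethe equation for the root `λ_k`, with the denominators cleared. -/
lemma prod_eq_of_solvesBAE {η : ℂ} {δ : ℂ → ℂ} {lam : Fin M → ℂ} (h : SolvesBAE η δ lam)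
    (k : Fin M) :
    ∏ i ∈ Finset.univ.erase k, sinh (lam i - lam k + η) / sinh (lam i - lam k) =
      (∏ i ∈ Finset.univ.erase k, sinh (lam i - lam k + -η) / sinh (lam i - lam k)) *
        δ (lam k) := by
  obtain ⟨h1, h2, h3⟩ := h k
  have h4 : ∏ i ∈ Finset.univ.erase k, sinh (lam i - lam k + -η) / sinh (lam i - lam k) =
      (∏ i ∈ Finset.univ.erase k, sinh (lam k - lam i + η) / sinh (lam k - lam i - η)) *
        ∏ i ∈ Finset.univ.erase k, sinh (lam i - lam k + η) / sinh (lam i - lam k) := by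
    rw [← Finset.prod_mul_distrib]
    refine Finset.prod_congr rfl fun i hi => ?_
    have hne := h2 i (Finset.ne_of_mem_erase hi)
    rw [show lam i - lam k + -η = -(lam k - lam i + η) by ring,
      show lam i - lam k + η = -(lam k - lam i - η) by ring, sinh_neg, sinh_neg]
    field_simp
  rw [h4, ← h3]
  field_simp

lemma transfer_mul_bethe {η : ℂ} (w : Fin L → ℂ) {lam : Fin M → ℂ}
    (hw : ∀ i j, sinh (w i - w j + η) ≠ 0)
    (hlam : ∀ β j, sinh (lam β - w j + η) ≠ 0)
    (hlam' : ∀ β j, sinh (lam β - w j) ≠ 0)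
    (hdist : ∀ α β, α ≠ β → sinh (lam α - lam β) ≠ 0)
    (hBAE : SolvesBAE η (d η w) lam) (k : Fin L) :
    transfer η w (List.finRange L).reverse (w k) *
        ((List.ofFn fun β => B η w (lam β)).prod * vac L) =
      (∏ β, b η (lam β - w k))⁻¹ • ((List.ofFn fun β => B η w (lam β)).prod * vac L) := by
  set l := (List.finRange L).reverse with hl
  have hnd : l.Nodup := List.nodup_reverse.2 (List.nodup_finRange L)
  let P : ℂ → Prop := fun z => ∀ j, sinh (z - w j + η) ≠ 0
  have hI : ∀ x y, P x → P y → Intertwines (weight η (x - y)) (monodromy η w l x)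
      (monodromy η w l y) := fun x y hx hy =>
    intertwines_monodromy η w hnd (fun j _ => hx j) (fun j _ => hy j)
  have hd : ∀ z, (l.map fun j => b η (z - w j)).prod = d η w z := fun z => by
    rw [d, hl, List.map_reverse, List.prod_reverse, ← List.ofFn_eq_map, List.prod_ofFn]
  have hcomm : ∀ i j, Commute (B η w (lam i)) (B η w (lam j)) := by
    intro i j
    by_cases hij : i = j
    · rw [hij]
    · rw [B, B, T_eq_monodromy, T_eq_monodromy]
      refine ((hI _ _ (hlam j) (hlam i)).B_mul_B ?_).symm
      rw [show lam j - lam i + η = -(lam i - lam j - η) by ring, sinh_neg, neg_ne_zero]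
      exact (hBAE i).2.1 j (Ne.symm hij)
  -- The off-shell formula deletes single roots, so the products of `B` are indexed by finite sets.
  let β : Finset (Fin M) → Op L := fun S =>
    S.noncommProd (fun i => B η w (lam i)) fun i _ j _ _ => hcomm i j
  have hβ0 : β ∅ = 1 := Finset.noncommProd_empty _ _
  have hβ : ∀ i S, i ∉ S → β (insert i S) = B η w (lam i) * β S := fun i S hi =>
    Finset.noncommProd_insert_of_notMem _ _ _ _ hi
  have hβu : β Finset.univ = (List.ofFn fun β => B η w (lam β)).prod := by
    simp only [β, Finset.noncommProd, Fin.univ_def, Multiset.map_coe, Multiset.noncommProd_coe,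
      List.ofFn_eq_map]
  have hc' : ∀ i ∈ Finset.univ, Commute (B η w (lam i)) (B η w (w k)) := fun i _ => by
    rw [B, B, T_eq_monodromy, T_eq_monodromy]
    exact (hI _ _ (hlam i) (hw k)).B_mul_B (hlam i k)
  have hA := mul_prod_B (η := η) (X := fun z => monodromy η w l z 0 0) (B := B η w) (V := vac L)
    (a := fun _ => 1) (P := P) (x := lam) (β := β)
    (fun z _ => by rw [one_smul]; exact (monodromy_mul_vac η w hnd z).1)
    (fun x y hx hy hs => by
      rw [B, B, T_eq_monodromy, T_eq_monodromy]
      exact (hI x y hx hy).A_mul_B hs)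
    hβ0 hβ hlam hdist hcomm Finset.univ (w k) (hw k) (fun i _ => hlam' i k) hc'
  have hD := mul_prod_B (η := -η) (X := fun z => monodromy η w l z 1 1) (B := B η w) (V := vac L)
    (a := d η w) (P := P) (x := lam) (β := β)
    (fun z _ => by rw [← hd]; exact (monodromy_mul_vac η w hnd z).2.2)
    (fun x y hx hy hs => by
      rw [B, B, T_eq_monodromy, T_eq_monodromy]
      exact (hI y x hy hx).D_mul_B hs)
    hβ0 hβ hlam hdist hcomm Finset.univ (w k) (hw k) (fun i _ => hlam' i k) hc'
  -- The factor `b(0) = 0` removes `D` from the eigenvalue at `w k`; only the contribution of `A`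
  -- survives.
  have hd0 : d η w (w k) = 0 := Finset.prod_eq_zero (Finset.mem_univ k) (by simp [b])
  have hf : (∏ β, b η (lam β - w k))⁻¹ =
      ∏ i, sinh (lam i - w k + η) / sinh (lam i - w k) := by
    rw [← Finset.prod_inv_distrib]
    exact Finset.prod_congr rfl fun i _ => by rw [b, inv_div]
  rw [← hβu, transfer, add_mul]
  rw [hA, hD, hd0, hf, mul_zero, zero_smul, mul_one, zero_sub, sub_add_eq_add_sub, ← sub_eq_add_neg,
    sub_sub, ← Finset.sum_add_distrib, Finset.sum_eq_zero, sub_zero]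
  intro i _
  -- The unwanted terms of `A` and `D` carry `sinh η` and `sinh (-η)`; by the Bethe equation they
  -- cancel root by root.
  rw [← add_smul, prod_eq_of_solvesBAE hBAE i, sinh_neg]
  convert zero_smul ℂ _
  ring

/-- The local operators in terms of the monodromy matrix, on a Bethe vector. -/
lemma matrixElement_eq {N ℓ : ℕ} {η : ℂ} (hη : sinh η ≠ 0) (w : Fin L → ℂ) (mu : Fin N → ℂ)
    {lam : Fin M → ℂ} (hw : ∀ i j, sinh (w i - w j + η) ≠ 0)
    (hlam : ∀ β j, sinh (lam β - w j + η) ≠ 0)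
    (hlam' : ∀ β j, sinh (lam β - w j) ≠ 0)
    (hdist : ∀ α β, α ≠ β → sinh (lam α - lam β) ≠ 0)
    (hBAE : SolvesBAE η (d η w) lam) (f : Fin ℓ → Fin L) {q : List (Fin L)}
    (hf : List.finRange L = (List.finRange ℓ).map f ++ q) (s s' : Fin ℓ → Fin 2) :
    matrixElement η w mu (List.ofFn fun k => T η w (w (f k)) (s k) (s' k)).prod lam =
      (phi η lam fun k => w (f k))⁻¹ *
        matrixElement η w mu (List.ofFn fun k => e (f k) (s' k) (s k)).prod lam := by
  have hrev : (List.finRange L).reverse = q.reverse ++ ((List.finRange ℓ).map f).reverse := by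
    rw [hf, List.reverse_append]
  have hprod := prod_e_mul_prod_transfer hη w hw f s s' (List.finRange ℓ) q.reverse
    (by rw [← hrev]; exact List.nodup_reverse.2 (List.nodup_finRange L))
  rw [← hrev] at hprod
  simp only [← T_eq_monodromy, ← List.ofFn_eq_map] at hprod
  set ψ := (List.ofFn fun β => B η w (lam β)).prod * vac L with hψ
  have heig : ∀ ks : List (Fin ℓ),
      (ks.map fun k => transfer η w (List.finRange L).reverse (w (f k))).prod * ψ =
        (ks.map fun k => ∏ β, b η (lam β - w (f k))).prod⁻¹ • ψ := by
    intro ks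
    induction ks with
    | nil => simp
    | cons k ks ih =>
      rw [List.map_cons, List.prod_cons, List.map_cons, List.prod_cons, mul_assoc, ih,
        mul_smul_comm, transfer_mul_bethe w hw hlam hlam' hdist hBAE, smul_smul, mul_inv,
        mul_comm]
  have heig := heig (List.finRange ℓ)
  rw [← List.ofFn_eq_map, ← List.ofFn_eq_map, List.prod_ofFn] at heig
  have hv : ∀ X, matrixElement η w mu X lam =
      vev ((List.ofFn fun α => C η w (mu α)).prod * (X * ψ)) := fun X => by
    rw [matrixElement, ← vev_mul_vac, mul_assoc, mul_assoc]
  rw [hv, hv, ← hprod, mul_assoc, heig, mul_smul_comm, mul_smul_comm]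
  rfl

end Eigenvector

/-! ### Continuity away from the poles. -/

section Limit

variable {L N M : ℕ} {F : Filter ℂ} {η : ℂ}

/-- The zeros of `sinh` are simple, since `cosh ^ 2 = 1` there, hence isolated along a nonconstant
affine line. -/
lemma eventually_sinh_affine_ne_zero (z : ℂ) {ρ : ℂ} (hρ : ρ ≠ 0) :
    ∀ᶠ ε in 𝓝[≠] (0 : ℂ), Complex.sinh (z + ε * ρ) ≠ 0 := by
  by_cases hz : Complex.sinh z = 0
  · have hd : HasDerivAt (fun ε : ℂ => Complex.sinh (z + ε * ρ))
        (Complex.cosh (z + 0 * ρ) * (1 * ρ)) 0 :=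
      (((hasDerivAt_id (0 : ℂ)).mul_const ρ).const_add z).csinh
    refine hd.eventually_ne ?_
    have := Complex.cosh_sq_sub_sinh_sq z
    rw [hz] at this
    rw [zero_mul, add_zero, one_mul]
    refine mul_ne_zero (fun h => ?_) hρ
    rw [h] at this
    norm_num at this
  · have hc : ContinuousAt (fun ε : ℂ => Complex.sinh (z + ε * ρ)) 0 := by fun_prop
    exact (hc.eventually_ne (by simpa using hz)).filter_mono nhdsWithin_le_nhds

lemma tendsto_R0 {j : Fin L} {u : ℂ → ℂ} {u₀ : ℂ} (hu : Tendsto u F (𝓝 u₀))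
    (h : Complex.sinh (u₀ + η) ≠ 0) : Tendsto (fun ε => R0 η j (u ε)) F (𝓝 (R0 η j u₀)) := by
  have hs : Tendsto (fun ε => Complex.sinh (u ε + η)) F (𝓝 (Complex.sinh (u₀ + η))) :=
    (Complex.continuous_sinh.tendsto _).comp (hu.add_const η)
  have hb : Tendsto (fun ε => b η (u ε)) F (𝓝 (b η u₀)) :=
    ((Complex.continuous_sinh.tendsto _).comp hu).div hs h
  have hc : Tendsto (fun ε => c η (u ε)) F (𝓝 (c η u₀)) := tendsto_const_nhds.div hs h
  have hR : ∀ p q, Tendsto (fun ε => R η (u ε) p q) F (𝓝 (R η u₀ p q)) := by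
    intro p q
    unfold R
    split_ifs
    exacts [tendsto_const_nhds, hb, hc, tendsto_const_nhds]
  refine tendsto_pi_nhds.2 fun a => tendsto_pi_nhds.2 fun a' => ?_
  exact tendsto_finsetSum _ fun x _ => tendsto_finsetSum _ fun y _ =>
    (hR _ _).smul tendsto_const_nhds

lemma tendsto_T {w : ℂ → Fin L → ℂ} {w₀ : Fin L → ℂ}
    (hw : ∀ j, Tendsto (fun ε => w ε j) F (𝓝 (w₀ j))) {x : ℂ → ℂ} {x₀ : ℂ} (hx : Tendsto x F (𝓝 x₀))
    (h : ∀ j, Complex.sinh (x₀ - w₀ j + η) ≠ 0) :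
    Tendsto (fun ε => T η (w ε) (x ε)) F (𝓝 (T η w₀ x₀)) := by
  simp only [T_eq_monodromy, monodromy]
  exact tendsto_list_prod _ fun j _ => tendsto_R0 (hx.sub (hw j)) (h j)

lemma tendsto_matrixElement {w : ℂ → Fin L → ℂ} {w₀ : Fin L → ℂ}
    (hw : ∀ j, Tendsto (fun ε => w ε j) F (𝓝 (w₀ j))) {mu : Fin N → ℂ} (X : Op L)
    {lam : ℂ → Fin M → ℂ} {lam₀ : Fin M → ℂ}
    (hlam : ∀ β, Tendsto (fun ε => lam ε β) F (𝓝 (lam₀ β)))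
    (hmu : ∀ α j, Complex.sinh (mu α - w₀ j + η) ≠ 0)
    (hlam₀ : ∀ β j, Complex.sinh (lam₀ β - w₀ j + η) ≠ 0) :
    Tendsto (fun ε => matrixElement η (w ε) mu X (lam ε)) F
      (𝓝 (matrixElement η w₀ mu X lam₀)) := by
  have hC : Tendsto (fun ε => (List.ofFn fun α => C η (w ε) (mu α)).prod) F
      (𝓝 (List.ofFn fun α => C η w₀ (mu α)).prod) := by
    simp only [List.ofFn_eq_map]
    exact tendsto_list_prod _ fun α _ => tendsto_pi_nhds.1
      (tendsto_pi_nhds.1 (tendsto_T hw tendsto_const_nhds (hmu α)) 1) 0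
  have hB : Tendsto (fun ε => (List.ofFn fun β => B η (w ε) (lam ε β)).prod) F
      (𝓝 (List.ofFn fun β => B η w₀ (lam₀ β)).prod) := by
    simp only [List.ofFn_eq_map]
    exact tendsto_list_prod _ fun β _ => tendsto_pi_nhds.1
      (tendsto_pi_nhds.1 (tendsto_T hw (hlam β) (hlam₀ β)) 0) 1
  exact tendsto_pi_nhds.1 (tendsto_pi_nhds.1 ((hC.mul tendsto_const_nhds).mul hB) _) _

lemma tendsto_phi {m : ℕ} {v : ℂ → Fin m → ℂ} {v₀ : Fin m → ℂ}
    (hv : ∀ j, Tendsto (fun ε => v ε j) F (𝓝 (v₀ j)))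
    {lam : ℂ → Fin M → ℂ} {lam₀ : Fin M → ℂ}
    (hlam : ∀ β, Tendsto (fun ε => lam ε β) F (𝓝 (lam₀ β)))
    (h : ∀ β j, Complex.sinh (lam₀ β - v₀ j + η) ≠ 0) :
    Tendsto (fun ε => phi η (lam ε) (v ε)) F (𝓝 (phi η lam₀ v₀)) := by
  refine tendsto_finsetProd _ fun j _ => tendsto_finsetProd _ fun β _ => ?_
  have hu := (hlam β).sub (hv j)
  exact ((Complex.continuous_sinh.tendsto _).comp hu).div
    ((Complex.continuous_sinh.tendsto _).comp (hu.add_const η)) (h β j)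

end Limit

/-! ### Almost complete strings. -/

section String

variable {Ns ℓ M : ℕ} {η : ℂ}

lemma tendsto_string (η : ℂ) (ξ : Fin Ns → ℂ) (r : Fin Ns → Fin ℓ → ℂ) (E : Set ℂ)
    (j : Fin (Ns * ℓ)) :
    Tendsto (fun ε => string η ξ r ε j) (𝓝[E] (0 : ℂ)) (𝓝 (string η ξ r 0 j)) := by
  have : Continuous fun ε => string η ξ r ε j := by
    unfold string
    fun_prop
  exact (this.tendsto 0).mono_left nhdsWithin_le_nhds

lemma eventually_string_sub_ne (hη : Complex.sinh η ≠ 0) (ξ : Fin Ns → ℂ)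
    {r : Fin Ns → Fin ℓ → ℂ} (hr : ∀ b β b' β', r b β = r b' β' → b = b' ∧ β = β') (E : Set ℂ)
    (i j : Fin (Ns * ℓ)) :
    ∀ᶠ ε in 𝓝[E \ {0}] (0 : ℂ),
      Complex.sinh (string η ξ r ε i - string η ξ r ε j + η) ≠ 0 := by
  by_cases hij : i = j
  · simp [hij, hη]
  -- For distinct sites the argument is affine in `ε` with slope the difference of the two
  -- parameters `r`.
  · have hρ : r i.divNat i.modNat - r j.divNat j.modNat ≠ 0 := fun h => hij <| by
      obtain ⟨h1, h2⟩ := hr _ _ _ _ (sub_eq_zero.1 h)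
      exact finProdFinEquiv.symm.injective (Prod.ext h1 h2)
    refine ((eventually_sinh_affine_ne_zero
      (string η ξ r 0 i - string η ξ r 0 j + η) hρ).filter_mono
        (nhdsWithin_mono _ fun x hx => hx.2)).mono fun ε h => ?_
    convert h using 2
    simp only [string]
    ring

/-- Solutions of the spin-`ℓ/2` equations avoid the zeros of `d(λ)` for complete strings. -/
lemma sinh_sub_string_ne_zero {ξ : Fin Ns → ℂ} {r : Fin Ns → Fin ℓ → ℂ} {lam : ℂ}
    (hlam : ∀ j, Complex.sinh (lam - string η ξ r 0 j + η) ≠ 0) (hd : dSpin ℓ η ξ lam ≠ 0)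
    (j : Fin (Ns * ℓ)) : Complex.sinh (lam - string η ξ r 0 j) ≠ 0 := by
  obtain ⟨⟨k, p⟩, rfl⟩ := finProdFinEquiv.surjective j
  have hs : ∀ p : Fin ℓ, string η ξ r 0 (finProdFinEquiv (k, p)) = ξ k - (p : ℕ) * η := by
    intro p
    have h := finProdFinEquiv.symm_apply_apply (k, p)
    simp only [finProdFinEquiv_symm_apply, Prod.mk.injEq] at h
    rw [string, h.1, h.2]
    ring
  rw [hs]
  rcases Nat.eq_zero_or_pos (p : ℕ) with h0 | h0
  · rw [h0, Nat.cast_zero, zero_mul, sub_zero]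
    exact (div_ne_zero_iff.1 (Finset.prod_ne_zero_iff.1 hd k (Finset.mem_univ k))).1
  -- Neighbours in a string are `η` apart, so a zero of the numerator at site `p ≥ 1` would be a
  -- zero of the denominator at site `p - 1`.
  · have h := hlam (finProdFinEquiv (k, ⟨p - 1, by omega⟩))
    rw [hs] at h
    convert h using 2
    push_cast [Nat.cast_sub h0]
    ring

/-- After reversal, the first string occupies the rightmost factors of `T`, as the inverse problem
requires. -/
lemma finRange_eq_map_site_append [NeZero Ns] :
    List.finRange (Ns * ℓ) =
      (List.finRange ℓ).map site ++ (List.finRange (Ns * ℓ)).drop ℓ := by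
  conv_lhs => rw [← List.take_append_drop ℓ (List.finRange (Ns * ℓ))]
  congr 1
  have hle : ℓ ≤ Ns * ℓ := Nat.le_mul_of_pos_left ℓ (NeZero.pos Ns)
  refine List.ext_getElem (by simp [hle]) fun i h1 h2 => ?_
  ext
  simp [site]

end String

end XXZ

/-! ### The limit to complete strings. -/

theorem proposition4p4 {Ns ℓ N M : ℕ} [NeZero Ns] (η : ℂ) (hη : Complex.sinh η ≠ 0)
    (ξ : Fin Ns → ℂ) (r : Fin Ns → Fin ℓ → ℂ)
    -- the parameters `r_b^{(β)}` are generic: pairwise distinct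
    (hr : ∀ b β b' β', r b β = r b' β' → b = b' ∧ β = β')
    -- `ε` tends to `0` through the nonzero elements of `E`
    (E : Set ℂ) (hE : (0 : ℂ) ∈ closure (E \ {0}))
    (mu : Fin N → ℂ) (lam : Fin M → ℂ) (lamE : ℂ → Fin M → ℂ)
    -- the monodromy matrix with complete strings has no pole at the parameters `μ_α` and `λ_β`
    (hmu : ∀ α j, Complex.sinh (mu α - XXZ.string η ξ r 0 j + η) ≠ 0)
    (hlam : ∀ β j, Complex.sinh (lam β - XXZ.string η ξ r 0 j + η) ≠ 0)
    (hBAE : XXZ.SolvesBAE η (XXZ.dSpin ℓ η ξ) lam)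
    (hBAEε : ∀ᶠ ε in 𝓝[E \ {0}] (0 : ℂ),
      XXZ.SolvesBAE η (XXZ.d η (XXZ.string η ξ r ε)) (lamE ε))
    -- the roots of the spin-1/2 equations are distinct modulo `π i`
    (hdist : ∀ᶠ ε in 𝓝[E \ {0}] (0 : ℂ),
      ∀ α β, α ≠ β → Complex.sinh (lamE ε α - lamE ε β) ≠ 0)
    (hlim : ∀ β, Tendsto (fun ε => lamE ε β) (𝓝[E \ {0}] (0 : ℂ)) (𝓝 (lam β)))
    -- `s k` is `ε_k` and `s' k` is `ε'_k`
    (s s' : Fin ℓ → Fin 2) :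
    ∃ y : ℂ,
      Tendsto
        (fun ε => XXZ.matrixElement η (XXZ.string η ξ r ε) mu
          (List.ofFn fun k : Fin ℓ =>
            XXZ.T η (XXZ.string η ξ r ε) (XXZ.string η ξ r ε (XXZ.site k)) (s k) (s' k)).prod
          (lamE ε))
        (𝓝[E \ {0}] (0 : ℂ)) (𝓝 y) ∧
      XXZ.matrixElement η (XXZ.string η ξ r 0) mu
          (List.ofFn fun k : Fin ℓ => XXZ.e (XXZ.site k : Fin (Ns * ℓ)) (s' k) (s k)).prod lam =
        XXZ.phi η lam (fun k : Fin ℓ => XXZ.string η ξ r 0 (XXZ.site k)) * y := by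
  set w := XXZ.string η ξ r with hw
  have hw0 : ∀ j, Tendsto (fun ε => w ε j) (𝓝[E \ {0}] (0 : ℂ)) (𝓝 (w 0 j)) :=
    XXZ.tendsto_string η ξ r _
  have hlam' : ∀ β j, Complex.sinh (lam β - w 0 j) ≠ 0 := fun β =>
    XXZ.sinh_sub_string_ne_zero (hlam β) (hBAE β).1
  have hphi : XXZ.phi η lam (fun k : Fin ℓ => w 0 (XXZ.site k)) ≠ 0 :=
    Finset.prod_ne_zero_iff.2 fun k _ => Finset.prod_ne_zero_iff.2 fun β _ =>
      div_ne_zero (hlam' β _) (hlam β _)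
  set X : XXZ.Op (Ns * ℓ) := (List.ofFn fun k : Fin ℓ => XXZ.e (XXZ.site k) (s' k) (s k)).prod
  refine ⟨(XXZ.phi η lam fun k : Fin ℓ => w 0 (XXZ.site k))⁻¹ *
    XXZ.matrixElement η (w 0) mu X lam, ?_, (mul_inv_cancel_left₀ hphi _).symm⟩
  -- The limit is computed for `φ(ε)⁻¹` times the element with local operators, which is regular at
  -- `ε = 0`; it remains to identify the two functions for small `ε ≠ 0`.
  refine (((XXZ.tendsto_phi (fun k => hw0 (XXZ.site k)) hlim fun β k => hlam β _).inv₀ hphi).mul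
    (XXZ.tendsto_matrixElement hw0 X hlim hmu hlam)).congr' ?_
  have hsub : ∀ β j, Tendsto (fun ε => lamE ε β - w ε j) (𝓝[E \ {0}] (0 : ℂ))
      (𝓝 (lam β - w 0 j)) := fun β j => (hlim β).sub (hw0 j)
  have h1 : ∀ᶠ ε in 𝓝[E \ {0}] (0 : ℂ), ∀ β j, Complex.sinh (lamE ε β - w ε j + η) ≠ 0 :=
    eventually_all.2 fun β => eventually_all.2 fun j =>
      ((Complex.continuous_sinh.tendsto _).comp ((hsub β j).add_const η)).eventually_ne (hlam β j)
  have h2 : ∀ᶠ ε in 𝓝[E \ {0}] (0 : ℂ), ∀ β j, Complex.sinh (lamE ε β - w ε j) ≠ 0 :=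
    eventually_all.2 fun β => eventually_all.2 fun j =>
      ((Complex.continuous_sinh.tendsto _).comp (hsub β j)).eventually_ne (hlam' β j)
  have h3 : ∀ᶠ ε in 𝓝[E \ {0}] (0 : ℂ), ∀ i j, Complex.sinh (w ε i - w ε j + η) ≠ 0 :=
    eventually_all.2 fun i => eventually_all.2 fun j =>
      XXZ.eventually_string_sub_ne hη ξ hr E i j
  filter_upwards [h1, h2, h3, hdist, hBAEε] with ε h1 h2 h3 h4 h5
  exact (XXZ.matrixElement_eq hη (w ε) mu h3 h1 h2 h4 h5 XXZ.site
    XXZ.finRange_eq_map_site_append s s').symm
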